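/- Let $\mu\ge 0$, let $H^1_0(0,1)=\{v\in H^1(0,1): v(0)=v(1)=0\}$ (real-valued functions), and let $\psi\in H^1_0(0,1)$, $\psi\neq 0$, be a weak solution of $-\psi''+\mu\psi-\psi^3=0$ on $(0,1)$ with $\psi(0)=\psi(1)=0$, i.e. $$\int_0^1\big[\psi_x v_x+\mu\psi v-\psi^3 v\big]\,dx=0\qquad\text{for all } v\in H^1_0(0,1).$$ Then (identifying $\psi$ with its continuous representative): (i) $\psi\in C^\infty(0,1)\cap C[0,1]$, and $\psi$ is a classical solution: $-\psi''+\mu\psi-\psi^3=0$ pointwise on $(0,1)$ and $\psi(0)=\psi(1)=0$. (ii) There is $j\in\{0,1,2,\dots\}$ such that $\psi$ has exactly $j$ zeros in $(0,1)$. (iii) For this $j$ the equation $\mu=4(j+1)^2(2k^2-1)K(k)^2$ has exactly one solution $k=k_j(\mu)\in[0,1)$, where $K(k)=\int_0^{\pi/2}(1-k^2\sin^2 t)^{-1/2}\,dt$, and either $\psi=\phi_j$ or $\psi=-\phi_j$ on $[0,1]$, where, with the Jacobi elliptic function $\mathrm{cn}$ and $[j]_2:=j \bmod 2$, $$\phi_j(x)=2\sqrt2\,(j+1)\,k\,K(k)\;\mathrm{cn}\Big(2(j+1)K(k)\big(x-\tfrac12\big)+[j]_2K(k),\,k\Big).$$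 If $\mu>0$, then also $$\phi_j(x)=\frac{\sqrt{2\mu}\,k}{\sqrt{2k^2-1}}\;\mathrm{cn}\Big(\frac{\sqrt\mu\,(x-\frac12)}{\sqrt{2k^2-1}}+[j]_2K(k),\,k\Big)\qquad(x\in\mathbb R).$$ -/

import Mathlib

open MeasureTheory Set
open scoped ContDiff

/-- Lebesgue measure on the open unit interval. -/
noncomputable def unitVol : Measure ℝ := volume.restrict (Ioo (0 : ℝ) 1)

/-- The function `u` belongs to `H¹(0,1)` and `u'` is (a representative of) its weak derivative.
Functions on the interval are represented by functions on the line; their values outside of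
`(0,1)` play no role. -/
structure MemH1 (u u' : ℝ → ℝ) : Prop where
  memLp : MemLp u 2 unitVol
  memLp_deriv : MemLp u' 2 unitVol
  weak_deriv : ∀ η : ℝ → ℝ, ContDiff ℝ ∞ η → HasCompactSupport η → tsupport η ⊆ Ioo (0 : ℝ) 1 →
    ∫ x, u x * deriv η x ∂unitVol = -∫ x, u' x * η x ∂unitVol

/-- The function `u` belongs to `H¹₀(0,1) = {v ∈ H¹(0,1) | v(0) = v(1) = 0}`, with weak
derivative `u'`. The boundary values are those of the continuous representative on `[0,1]`. -/
structure MemH10 (u u' : ℝ → ℝ) : Prop extends MemH1 u u' where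
  boundary : ∃ w : ℝ → ℝ, ContinuousOn w (Icc (0 : ℝ) 1) ∧ w =ᵐ[unitVol] u ∧ w 0 = 0 ∧ w 1 = 0

/-- Incomplete elliptic integral of the first kind `F(θ, k)`. -/
noncomputable def ellF (k θ : ℝ) : ℝ :=
  ∫ t in (0 : ℝ)..θ, 1 / Real.sqrt (1 - k ^ 2 * Real.sin t ^ 2)

/-- Complete elliptic integral of the first kind `K(k)`. -/
noncomputable def ellK (k : ℝ) : ℝ := ellF k (Real.pi / 2)

/-- Jacobi amplitude `am(u, k)`: the inverse function of `θ ↦ F(θ, k)`, which is a bijection of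
the line for `0 ≤ k < 1`. -/
noncomputable def jacobiAm (u k : ℝ) : ℝ := Function.invFun (ellF k) u

/-- Jacobi elliptic function `cn(u, k)`. -/
noncomputable def jacobiCn (u k : ℝ) : ℝ := Real.cos (jacobiAm u k)

/-- For `0 ≤ k < 1`, the map `θ ↦ F(θ, k)` is a bijection of the line. -/
theorem ellF_bijective {k : ℝ} (hk : k ∈ Ico (0 : ℝ) 1) : Function.Bijective (ellF k) := by
  have hk2 : k ^ 2 < 1 := by nlinarith [hk.1, hk.2]
  have hpos : ∀ t : ℝ, 0 < 1 - k ^ 2 * Real.sin t ^ 2 := fun t => by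
    nlinarith [Real.sin_sq_le_one t, sq_nonneg k, sq_nonneg (Real.sin t)]
  have hcont : Continuous fun t : ℝ => 1 / Real.sqrt (1 - k ^ 2 * Real.sin t ^ 2) :=
    Continuous.div continuous_const (by fun_prop)
      (fun t => (Real.sqrt_pos.2 (hpos t)).ne')
  have hint : ∀ a b : ℝ, IntervalIntegrable
      (fun t : ℝ => 1 / Real.sqrt (1 - k ^ 2 * Real.sin t ^ 2)) volume a b :=
    fun a b => hcont.intervalIntegrable a b
  have hone : ∀ t : ℝ, 1 ≤ 1 / Real.sqrt (1 - k ^ 2 * Real.sin t ^ 2) := fun t => by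
    rw [le_div_iff₀ (Real.sqrt_pos.2 (hpos t)), one_mul]
    exact Real.sqrt_le_one.2 (by nlinarith [mul_nonneg (sq_nonneg k) (sq_nonneg (Real.sin t))])
  have hgrow : ∀ a b : ℝ, a ≤ b → b - a ≤ ellF k b - ellF k a := fun a b hab => by
    have h1 : ellF k b - ellF k a
        = ∫ t in a..b, 1 / Real.sqrt (1 - k ^ 2 * Real.sin t ^ 2) :=
      intervalIntegral.integral_interval_sub_left (hint 0 b) (hint 0 a)
    have h2 := intervalIntegral.integral_mono_on hab
      (continuous_const.intervalIntegrable (μ := volume) a b) (hint a b) (fun t _ => hone t)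
    rw [h1]
    simpa using h2
  have h0 : ellF k 0 = 0 := by simp [ellF]
  have hc : Continuous (ellF k) := by
    unfold ellF
    exact intervalIntegral.continuous_primitive hint 0
  refine ⟨fun a b hab => ?_, hc.surjective ?_ ?_⟩
  · rcases le_total a b with h | h
    · linarith [hgrow a b h]
    · linarith [hgrow b a h]
  · refine Filter.tendsto_atTop_mono' _ ?_ Filter.tendsto_id
    filter_upwards [Filter.eventually_ge_atTop (0 : ℝ)] with x hx
    have := hgrow 0 x hx
    simp only [id]
    linarith
  · refine Filter.tendsto_atBot_mono' _ ?_ Filter.tendsto_id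
    filter_upwards [Filter.eventually_le_atBot (0 : ℝ)] with x hx
    have := hgrow x 0 hx
    simp only [id]
    linarith

/-- `k ∈ [0,1)` solves `μ = 4 (j+1)² (2k² - 1) K(k)²`. -/
def IsModulus (μ : ℝ) (j : ℕ) (k : ℝ) : Prop :=
  k ∈ Ico (0 : ℝ) 1 ∧ μ = 4 * ((j : ℝ) + 1) ^ 2 * (2 * k ^ 2 - 1) * ellK k ^ 2

/-- `2√2 (j+1) k K(k) cn(2 (j+1) K(k) (x - 1/2) + [j]₂ K(k), k)`, where `[j]₂ = j mod 2`. -/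
noncomputable def boundState (j : ℕ) (k x : ℝ) : ℝ :=
  2 * Real.sqrt 2 * ((j : ℝ) + 1) * k * ellK k *
    jacobiCn (2 * ((j : ℝ) + 1) * ellK k * (x - 1 / 2) + ((j % 2 : ℕ) : ℝ) * ellK k) k

/-- `√(2μ) k / √(2k²-1) · cn(√μ (x - 1/2) / √(2k²-1) + [j]₂ K(k), k)`, used for `μ > 0`. -/
noncomputable def boundStateFreq (μ : ℝ) (j : ℕ) (k x : ℝ) : ℝ :=
  Real.sqrt (2 * μ) * k / Real.sqrt (2 * k ^ 2 - 1) *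
    jacobiCn (Real.sqrt μ * (x - 1 / 2) / Real.sqrt (2 * k ^ 2 - 1)
      + ((j % 2 : ℕ) : ℝ) * ellK k) k

/-! Testing with smooth functions shows that `ψ'` agrees a.e. with a primitive of `μψ - ψ³` up to a
constant, so `ψ` agrees a.e. with a classical solution `u` (`exists_classical_solution`). The rest
is shooting from `x = 0`. Since `u 0 = 0` and `u` is not zero, `u' 0 ≠ 0` by uniqueness for the
initial value problem, and `u' 0 > 0` up to sign. The waves `√2 k w cn(w x - K, k)` with `μ = w²
(2k² - 1)` solve the equation, vanish at `0` and attain every positive slope there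
(`exists_modulus_frequency`), so `u` is one of them. The condition `u 1 = 0` forces `w = 2 (j+1) K`
for some `j`, which gives both the zero count and the modulus equation. Thus existence of the
modulus comes from `u` itself; only its uniqueness uses monotonicity in `k`. -/

section Jacobi

/-! ### Elliptic integrals, the amplitude and `cn`. -/

variable {k : ℝ}

theorem one_sub_sq_mul_sin_sq_pos (hk : k ∈ Ico (0 : ℝ) 1) (t : ℝ) :
    0 < 1 - k ^ 2 * Real.sin t ^ 2 := by
  have hk2 : k ^ 2 < 1 := by nlinarith [hk.1, hk.2]
  nlinarith [Real.sin_sq_le_one t, sq_nonneg k, sq_nonneg (Real.sin t)]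

theorem continuous_ellF_integrand (hk : k ∈ Ico (0 : ℝ) 1) :
    Continuous fun t : ℝ => 1 / Real.sqrt (1 - k ^ 2 * Real.sin t ^ 2) :=
  Continuous.div continuous_const (by fun_prop)
    (fun t => (Real.sqrt_pos.2 (one_sub_sq_mul_sin_sq_pos hk t)).ne')

theorem hasDerivAt_ellF (hk : k ∈ Ico (0 : ℝ) 1) (θ : ℝ) :
    HasDerivAt (ellF k) (1 / Real.sqrt (1 - k ^ 2 * Real.sin θ ^ 2)) θ :=
  (continuous_ellF_integrand hk).integral_hasStrictDerivAt 0 θ |>.hasDerivAt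

theorem strictMono_ellF (hk : k ∈ Ico (0 : ℝ) 1) : StrictMono (ellF k) :=
  strictMono_of_hasDerivAt_pos (hasDerivAt_ellF hk) fun θ =>
    one_div_pos.2 (Real.sqrt_pos.2 (one_sub_sq_mul_sin_sq_pos hk θ))

theorem ellF_zero (k : ℝ) : ellF k 0 = 0 := by simp [ellF]

theorem ellF_neg (k θ : ℝ) : ellF k (-θ) = -ellF k θ := by
  unfold ellF
  have h := intervalIntegral.integral_comp_neg (a := 0) (b := θ)
    (fun t => 1 / Real.sqrt (1 - k ^ 2 * Real.sin t ^ 2))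
  simp only [Real.sin_neg, neg_sq, neg_zero] at h
  rw [h, intervalIntegral.integral_symm]

theorem ellK_pos (hk : k ∈ Ico (0 : ℝ) 1) : 0 < ellK k := by
  rw [ellK, ← ellF_zero k]
  exact strictMono_ellF hk Real.pi_div_two_pos

/-- The integrand is even with period `π`, so its integral over any period is `2K`. -/
theorem ellF_add_pi (hk : k ∈ Ico (0 : ℝ) 1) (θ : ℝ) :
    ellF k (θ + Real.pi) = ellF k θ + 2 * ellK k := by
  have hint : ∀ a b : ℝ, IntervalIntegrable
      (fun t : ℝ => 1 / Real.sqrt (1 - k ^ 2 * Real.sin t ^ 2)) volume a b :=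
    fun a b => (continuous_ellF_integrand hk).intervalIntegrable a b
  have hper : Function.Periodic
      (fun t : ℝ => 1 / Real.sqrt (1 - k ^ 2 * Real.sin t ^ 2)) Real.pi := fun t => by
    simp [Real.sin_add_pi]
  have h1 : ellF k (θ + Real.pi) - ellF k θ
      = ∫ t in θ..θ + Real.pi, 1 / Real.sqrt (1 - k ^ 2 * Real.sin t ^ 2) :=
    intervalIntegral.integral_interval_sub_left (hint 0 _) (hint 0 _)
  have h2 : ellF k (Real.pi / 2) - ellF k (-(Real.pi / 2))
      = ∫ t in -(Real.pi / 2)..Real.pi / 2, 1 / Real.sqrt (1 - k ^ 2 * Real.sin t ^ 2) :=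
    intervalIntegral.integral_interval_sub_left (hint 0 _) (hint 0 _)
  have h3 := hper.intervalIntegral_add_eq θ (-(Real.pi / 2))
  rw [show -(Real.pi / 2) + Real.pi = Real.pi / 2 by ring, ← h2, ← h1, ellF_neg] at h3
  simp only [ellK]
  linarith

theorem ellF_jacobiAm (hk : k ∈ Ico (0 : ℝ) 1) (u : ℝ) : ellF k (jacobiAm u k) = u :=
  Function.rightInverse_invFun (ellF_bijective hk).2 u

theorem jacobiAm_ellF (hk : k ∈ Ico (0 : ℝ) 1) (θ : ℝ) : jacobiAm (ellF k θ) k = θ :=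
  Function.leftInverse_invFun (ellF_bijective hk).1 θ

theorem jacobiAm_add_two_mul_ellK (hk : k ∈ Ico (0 : ℝ) 1) (u : ℝ) :
    jacobiAm (u + 2 * ellK k) k = jacobiAm u k + Real.pi := by
  apply (ellF_bijective hk).1
  rw [ellF_jacobiAm hk, ellF_add_pi hk, ellF_jacobiAm hk]

theorem jacobiAm_neg_ellK (hk : k ∈ Ico (0 : ℝ) 1) :
    jacobiAm (-ellK k) k = -(Real.pi / 2) := by
  rw [ellK, ← ellF_neg, jacobiAm_ellF hk]

theorem continuous_jacobiAm (hk : k ∈ Ico (0 : ℝ) 1) : Continuous fun u => jacobiAm u k := by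
  refine Monotone.continuous_of_surjective (fun u v huv => ?_)
    fun θ => ⟨ellF k θ, jacobiAm_ellF hk θ⟩
  rwa [← (strictMono_ellF hk).le_iff_le, ellF_jacobiAm hk, ellF_jacobiAm hk]

theorem hasDerivAt_jacobiAm (hk : k ∈ Ico (0 : ℝ) 1) (u : ℝ) :
    HasDerivAt (fun u => jacobiAm u k)
      (Real.sqrt (1 - k ^ 2 * Real.sin (jacobiAm u k) ^ 2)) u := by
  have h := HasDerivAt.of_local_left_inverse (continuous_jacobiAm hk).continuousAt
    (hasDerivAt_ellF hk (jacobiAm u k))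
    (one_div_pos.2 (Real.sqrt_pos.2 (one_sub_sq_mul_sin_sq_pos hk _))).ne'
    (Filter.Eventually.of_forall fun y => ellF_jacobiAm hk y)
  simpa using h

theorem jacobiCn_add_two_mul_ellK (hk : k ∈ Ico (0 : ℝ) 1) (u : ℝ) :
    jacobiCn (u + 2 * ellK k) k = -jacobiCn u k := by
  simp [jacobiCn, jacobiAm_add_two_mul_ellK hk, Real.cos_add_pi]

theorem jacobiCn_add_nat_mul (hk : k ∈ Ico (0 : ℝ) 1) (n : ℕ) (u : ℝ) :
    jacobiCn (u + n * (2 * ellK k)) k = (-1) ^ n * jacobiCn u k := by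
  induction n with
  | zero => simp
  | succ n ih =>
    rw [show u + ((n + 1 : ℕ) : ℝ) * (2 * ellK k) = u + n * (2 * ellK k) + 2 * ellK k by
      push_cast; ring, jacobiCn_add_two_mul_ellK hk, ih, pow_succ]
    ring

theorem ellF_add_int_mul_pi (hk : k ∈ Ico (0 : ℝ) 1) (m : ℤ) (θ : ℝ) :
    ellF k (θ + m * Real.pi) = ellF k θ + m * (2 * ellK k) := by
  induction m with
  | zero => simp
  | succ n ih =>
    rw [show θ + ((n + 1 : ℤ) : ℝ) * Real.pi = θ + (n : ℤ) * Real.pi + Real.pi by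
      push_cast; ring, ellF_add_pi hk, ih]
    push_cast
    ring
  | pred n ih =>
    have h := ellF_add_pi hk (θ + ((-n - 1 : ℤ) : ℝ) * Real.pi)
    rw [show θ + ((-n - 1 : ℤ) : ℝ) * Real.pi + Real.pi = θ + (-n : ℤ) * Real.pi by
      push_cast; ring, ih] at h
    push_cast at h ⊢
    linarith

/-- The amplitude at `-K` is `-π/2`, so the cosine becomes a sine with zeros in `πℤ`, which `F`
carries to multiples of `2K`. -/
theorem jacobiCn_sub_ellK_eq_zero_iff (hk : k ∈ Ico (0 : ℝ) 1) (u : ℝ) :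
    jacobiCn (u - ellK k) k = 0 ↔ ∃ m : ℤ, u = m * (2 * ellK k) := by
  have hcos : jacobiCn (u - ellK k) k = Real.sin (jacobiAm (u - ellK k) k + Real.pi / 2) := by
    rw [Real.sin_add_pi_div_two, jacobiCn]
  rw [hcos, Real.sin_eq_zero_iff]
  refine exists_congr fun m => ?_
  have hF := ellF_add_int_mul_pi hk m (-(Real.pi / 2))
  rw [ellF_neg, ← ellK] at hF
  constructor
  · intro h
    have h' : jacobiAm (u - ellK k) k = -(Real.pi / 2) + m * Real.pi := by linarith
    have := ellF_jacobiAm hk (u - ellK k)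
    rw [h', hF] at this
    linarith
  · intro h
    rw [show u - ellK k = -ellK k + m * (2 * ellK k) by linarith, ← hF, jacobiAm_ellF hk]
    ring

theorem ellK_mono {k l : ℝ} (hk : k ∈ Ico (0 : ℝ) 1) (hl : l ∈ Ico (0 : ℝ) 1) (hkl : k ≤ l) :
    ellK k ≤ ellK l := by
  refine intervalIntegral.integral_mono_on Real.pi_div_two_pos.le
    ((continuous_ellF_integrand hk).intervalIntegrable _ _)
    ((continuous_ellF_integrand hl).intervalIntegrable _ _) fun t _ => ?_
  have hsq : k ^ 2 ≤ l ^ 2 := pow_le_pow_left₀ hk.1 hkl 2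
  refine one_div_le_one_div_of_le (Real.sqrt_pos.2 (one_sub_sq_mul_sin_sq_pos hl t))
    (Real.sqrt_le_sqrt ?_)
  nlinarith [mul_le_mul_of_nonneg_right hsq (sq_nonneg (Real.sin t))]

/-- The derivative of `cn(w x - K, k)` with respect to `x`. -/
noncomputable def cnWaveDeriv (w k x : ℝ) : ℝ :=
  -(w * Real.sin (jacobiAm (w * x - ellK k) k) *
    Real.sqrt (1 - k ^ 2 * Real.sin (jacobiAm (w * x - ellK k) k) ^ 2))

theorem hasDerivAt_jacobiAm_affine (hk : k ∈ Ico (0 : ℝ) 1) (w x : ℝ) :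
    HasDerivAt (fun x => jacobiAm (w * x - ellK k) k)
      (Real.sqrt (1 - k ^ 2 * Real.sin (jacobiAm (w * x - ellK k) k) ^ 2) * w) x := by
  have h : HasDerivAt (fun x => w * x - ellK k) w x := by
    simpa using ((hasDerivAt_id x).const_mul w).sub_const (ellK k)
  exact (hasDerivAt_jacobiAm hk (w * x - ellK k)).comp x h

theorem hasDerivAt_cnWave (hk : k ∈ Ico (0 : ℝ) 1) (w x : ℝ) :
    HasDerivAt (fun x => jacobiCn (w * x - ellK k) k) (cnWaveDeriv w k x) x := by
  refine (hasDerivAt_jacobiAm_affine hk w x).cos.congr_deriv ?_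
  rw [cnWaveDeriv]
  ring

/-- This is `cn'' = (2k² - 1) cn - 2k² cn³`; amplitude `√2 k w` normalises the cubic coefficient to
one. -/
theorem hasDerivAt_cnWaveDeriv (hk : k ∈ Ico (0 : ℝ) 1) (w x : ℝ) :
    HasDerivAt (cnWaveDeriv w k)
      (w ^ 2 * ((2 * k ^ 2 - 1) * jacobiCn (w * x - ellK k) k
        - 2 * k ^ 2 * jacobiCn (w * x - ellK k) k ^ 3)) x := by
  have hpos := one_sub_sq_mul_sin_sq_pos hk (jacobiAm (w * x - ellK k) k)
  have h := hasDerivAt_jacobiAm_affine hk w x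
  have h2 := (((h.sin.fun_pow 2).const_mul (k ^ 2)).const_sub 1).sqrt hpos.ne'
  refine (((h.sin.const_mul w).mul h2).neg).congr_deriv ?_
  simp only [jacobiCn]
  set θ := jacobiAm (w * x - ellK k) k
  set S := Real.sqrt (1 - k ^ 2 * Real.sin θ ^ 2) with hS
  have hS0 : S ≠ 0 := (Real.sqrt_pos.2 hpos).ne'
  have hSS : S ^ 2 = 1 - k ^ 2 * Real.sin θ ^ 2 := Real.sq_sqrt hpos.le
  have hc : Real.cos θ ^ 3 = Real.cos θ * (1 - Real.sin θ ^ 2) := by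
    rw [← Real.cos_sq']; ring
  rw [hc]
  field_simp
  push_cast
  linear_combination (-2 * w ^ 2 * Real.cos θ) * hSS

end Jacobi

/-! ### Shooting from the left endpoint. -/

section Shooting

variable {μ : ℝ}

theorem eqOn_of_cubic_ode {u p v q : ℝ → ℝ}
    (hu : ∀ x ∈ Icc (0 : ℝ) 1, HasDerivAt u (p x) x)
    (hp : ∀ x ∈ Icc (0 : ℝ) 1, HasDerivAt p (μ * u x - u x ^ 3) x)
    (hv : ∀ x ∈ Icc (0 : ℝ) 1, HasDerivAt v (q x) x)
    (hq : ∀ x ∈ Icc (0 : ℝ) 1, HasDerivAt q (μ * v x - v x ^ 3) x)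
    (h0 : u 0 = v 0) (h0' : p 0 = q 0) : EqOn u v (Icc (0 : ℝ) 1) := by
  let F : ℝ × ℝ → ℝ × ℝ := fun z => (z.2, μ * z.1 - z.1 ^ 3)
  have hF : ContDiff ℝ 1 F := by fun_prop
  have hU : ∀ x ∈ Icc (0 : ℝ) 1, HasDerivAt (fun x => (u x, p x)) (F (u x, p x)) x :=
    fun x hx => (hu x hx).prodMk (hp x hx)
  have hV : ∀ x ∈ Icc (0 : ℝ) 1, HasDerivAt (fun x => (v x, q x)) (F (v x, q x)) x :=
    fun x hx => (hv x hx).prodMk (hq x hx)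
  have hUc : ContinuousOn (fun x => (u x, p x)) (Icc (0 : ℝ) 1) :=
    fun x hx => (hU x hx).continuousAt.continuousWithinAt
  have hVc : ContinuousOn (fun x => (v x, q x)) (Icc (0 : ℝ) 1) :=
    fun x hx => (hV x hx).continuousAt.continuousWithinAt
  -- The cubic field is only locally Lipschitz, so both trajectories are confined to one ball.
  obtain ⟨R, hR⟩ := ((isCompact_Icc.image_of_continuousOn hUc).union
    (isCompact_Icc.image_of_continuousOn hVc)).isBounded.subset_closedBall 0
  obtain ⟨K, hK⟩ := hF.contDiffOn.exists_lipschitzOnWith one_ne_zero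
    (convex_closedBall (0 : ℝ × ℝ) R) (isCompact_closedBall _ _)
  have h := ODE_solution_unique_of_mem_Icc_right (v := fun _ => F)
    (s := fun _ => Metric.closedBall 0 R) (fun _ _ => hK) hUc
    (fun x hx => (hU x (Ico_subset_Icc_self hx)).hasDerivWithinAt)
    (fun x hx => hR (Or.inl ⟨x, Ico_subset_Icc_self hx, rfl⟩)) hVc
    (fun x hx => (hV x (Ico_subset_Icc_self hx)).hasDerivWithinAt)
    (fun x hx => hR (Or.inr ⟨x, Ico_subset_Icc_self hx, rfl⟩)) (Prod.ext h0 h0')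
  exact fun x hx => congrArg Prod.fst (h hx)

/-- With `m = k²` and `D = w²` the conditions read `D (2m - 1) = μ` and `2 m (1 - m) D² = a²`.
Eliminating `m` leaves `D² = μ² + 2a²`. -/
theorem exists_modulus_frequency (μ : ℝ) {a : ℝ} (ha : 0 < a) :
    ∃ k ∈ Ioo (0 : ℝ) 1, ∃ w : ℝ, 0 < w ∧ μ = w ^ 2 * (2 * k ^ 2 - 1) ∧
      a = Real.sqrt 2 * k * w * (w * Real.sqrt (1 - k ^ 2)) := by
  set D := Real.sqrt (μ ^ 2 + 2 * a ^ 2) with hD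
  have hD2 : D ^ 2 = μ ^ 2 + 2 * a ^ 2 := Real.sq_sqrt (by positivity)
  have hDpos : 0 < D := Real.sqrt_pos.2 (by positivity)
  have hlt : |μ| < D := abs_lt_of_sq_lt_sq (by nlinarith) hDpos.le
  obtain ⟨h1, h2⟩ := abs_lt.1 hlt
  set m := (1 + μ / D) / 2 with hm
  have hm' : m = (D + μ) / (2 * D) := by rw [hm]; field_simp
  have hm0 : 0 < m := by rw [hm']; exact div_pos (by linarith) (by linarith)
  have hm1 : m < 1 := by rw [hm', div_lt_one (by linarith)]; linarith
  have hk2 : Real.sqrt m ^ 2 = m := Real.sq_sqrt hm0.le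
  have hw2 : Real.sqrt D ^ 2 = D := Real.sq_sqrt hDpos.le
  refine ⟨Real.sqrt m, ⟨Real.sqrt_pos.2 hm0, ?_⟩, Real.sqrt D, Real.sqrt_pos.2 hDpos, ?_, ?_⟩
  · rw [Real.sqrt_lt' one_pos]; simpa using hm1
  · rw [hk2, hw2, hm']; field_simp; ring
  · rw [hk2]
    have h1m : 0 < 1 - m := by linarith
    have hr : Real.sqrt (1 - m) ^ 2 = 1 - m := Real.sq_sqrt h1m.le
    have h22 : Real.sqrt 2 ^ 2 = 2 := Real.sq_sqrt two_pos.le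
    refine (sq_eq_sq₀ ha.le (by positivity)).1 ?_
    calc a ^ 2 = 2 * m * D ^ 2 * (1 - m) := by
          rw [hm']; field_simp; linear_combination (-1 : ℝ) * hD2
      _ = Real.sqrt 2 ^ 2 * Real.sqrt m ^ 2 * (Real.sqrt D ^ 2) ^ 2 * Real.sqrt (1 - m) ^ 2 := by
          rw [h22, hk2, hw2, hr]
      _ = _ := by ring

theorem jacobiCn_neg_ellK {k : ℝ} (hk : k ∈ Ico (0 : ℝ) 1) : jacobiCn (-ellK k) k = 0 := by
  simp [jacobiCn, jacobiAm_neg_ellK hk]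

theorem cnWaveDeriv_zero {k : ℝ} (hk : k ∈ Ico (0 : ℝ) 1) (w : ℝ) :
    cnWaveDeriv w k 0 = w * Real.sqrt (1 - k ^ 2) := by
  simp [cnWaveDeriv, jacobiAm_neg_ellK hk]

theorem exists_eq_cnWave {u p : ℝ → ℝ}
    (hu : ∀ x ∈ Icc (0 : ℝ) 1, HasDerivAt u (p x) x)
    (hp : ∀ x ∈ Icc (0 : ℝ) 1, HasDerivAt p (μ * u x - u x ^ 3) x)
    (h0 : u 0 = 0) (h0' : 0 < p 0) :
    ∃ k ∈ Ioo (0 : ℝ) 1, ∃ w : ℝ, 0 < w ∧ μ = w ^ 2 * (2 * k ^ 2 - 1) ∧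
      ∀ x ∈ Icc (0 : ℝ) 1, u x = Real.sqrt 2 * k * w * jacobiCn (w * x - ellK k) k := by
  obtain ⟨k, hk, w, hw, hμ, ha⟩ := exists_modulus_frequency μ h0'
  have hk' : k ∈ Ico (0 : ℝ) 1 := Ioo_subset_Ico_self hk
  refine ⟨k, hk, w, hw, hμ, ?_⟩
  have h22 : Real.sqrt 2 ^ 2 = 2 := Real.sq_sqrt two_pos.le
  refine eqOn_of_cubic_ode hu hp (q := fun x => Real.sqrt 2 * k * w * cnWaveDeriv w k x)
    (fun x _ => (hasDerivAt_cnWave hk' w x).const_mul _)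
    (fun x _ => ((hasDerivAt_cnWaveDeriv hk' w x).const_mul _).congr_deriv ?_) ?_ ?_
  · rw [hμ]
    linear_combination
      (Real.sqrt 2 * k ^ 3 * w ^ 3 * jacobiCn (w * x - ellK k) k ^ 3) * h22
  · simp [h0, jacobiCn_neg_ellK hk']
  · rw [cnWaveDeriv_zero hk', ha]

theorem exists_isModulus_eq_cnWave {u p : ℝ → ℝ}
    (hu : ∀ x ∈ Icc (0 : ℝ) 1, HasDerivAt u (p x) x)
    (hp : ∀ x ∈ Icc (0 : ℝ) 1, HasDerivAt p (μ * u x - u x ^ 3) x)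
    (h0 : u 0 = 0) (h1 : u 1 = 0) (h0' : 0 < p 0) :
    ∃ j : ℕ, ∃ k : ℝ, 0 < k ∧ IsModulus μ j k ∧ ∀ x ∈ Icc (0 : ℝ) 1,
      u x = Real.sqrt 2 * k * (2 * ((j : ℝ) + 1) * ellK k) *
        jacobiCn (2 * ((j : ℝ) + 1) * ellK k * x - ellK k) k := by
  obtain ⟨k, hk, w, hw, hμ, hcn⟩ := exists_eq_cnWave hu hp h0 h0'
  have hk' : k ∈ Ico (0 : ℝ) 1 := Ioo_subset_Ico_self hk
  have hK := ellK_pos hk'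
  have h := hcn 1 (right_mem_Icc.2 zero_le_one)
  have hA : Real.sqrt 2 * k * w ≠ 0 := by have := hk.1; positivity
  rw [h1, eq_comm, mul_eq_zero, or_iff_right hA, mul_one,
    jacobiCn_sub_ellK_eq_zero_iff hk'] at h
  obtain ⟨m, hm⟩ := h
  have hm0 : 0 < m := by
    have : (0 : ℝ) < m := by
      by_contra hneg
      nlinarith
    exact_mod_cast this
  -- The wave number `m` counts half-periods on `[0,1]`, one more than the interior zeros.
  obtain ⟨j, rfl⟩ : ∃ j : ℕ, m = j + 1 := ⟨(m - 1).toNat, by omega⟩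
  have hw' : w = 2 * ((j : ℝ) + 1) * ellK k := by rw [hm]; push_cast; ring
  refine ⟨j, k, hk.1, ⟨hk', ?_⟩, fun x hx => ?_⟩
  · rw [hμ, hw']; ring
  · rw [← hw']; exact hcn x hx

theorem encard_zeros_cnWave (j : ℕ) {k : ℝ} (hk : k ∈ Ico (0 : ℝ) 1) :
    {x ∈ Ioo (0 : ℝ) 1 |
      jacobiCn (2 * ((j : ℝ) + 1) * ellK k * x - ellK k) k = 0}.encard = (j : ℕ∞) := by
  have hK := ellK_pos hk
  have hj : (0 : ℝ) < (j : ℝ) + 1 := by positivity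
  have hset : {x ∈ Ioo (0 : ℝ) 1 |
      jacobiCn (2 * ((j : ℝ) + 1) * ellK k * x - ellK k) k = 0} =
      (fun i : ℕ => ((i : ℝ) + 1) / ((j : ℝ) + 1)) '' (Finset.range j : Set ℕ) := by
    ext x
    simp only [mem_ofPred_eq, jacobiCn_sub_ellK_eq_zero_iff hk, mem_image, Finset.coe_range,
      mem_Iio]
    constructor
    · rintro ⟨hx, m, hm⟩
      have hx' : ((j : ℝ) + 1) * x = m := by
        have : 2 * ellK k * (((j : ℝ) + 1) * x) = 2 * ellK k * m := by linarith
        exact mul_left_cancel₀ (by positivity) this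
      have hm0 : 0 < m := by
        have : (0 : ℝ) < m := hx' ▸ mul_pos hj hx.1
        exact_mod_cast this
      have hm1 : m < j + 1 := by
        have : (m : ℝ) < j + 1 := hx' ▸ mul_lt_of_lt_one_right hj hx.2
        exact_mod_cast this
      obtain ⟨i, rfl⟩ : ∃ i : ℕ, m = i + 1 := ⟨(m - 1).toNat, by omega⟩
      refine ⟨i, by omega, ?_⟩
      rw [div_eq_iff hj.ne', mul_comm, hx']
      push_cast
      rfl
    · rintro ⟨i, hi, rfl⟩
      have hi' : (i : ℝ) < j := by exact_mod_cast hi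
      refine ⟨⟨by positivity, (div_lt_one hj).2 (by linarith)⟩, i + 1, ?_⟩
      push_cast
      field_simp
  rw [hset, Function.Injective.encard_image, encard_coe_eq_coe_finsetCard, Finset.card_range]
  intro a b hab
  have : (a : ℝ) + 1 = b + 1 := (div_left_inj' hj.ne').1 hab
  exact_mod_cast add_right_cancel this

/-- Phases measured from `0` and from `1/2` differ by `j / 2` (integer division) half-periods `2K`,
each of which flips the sign. -/
theorem boundState_eq_cnWave (j : ℕ) {k : ℝ} (hk : k ∈ Ico (0 : ℝ) 1) (x : ℝ) :
    Real.sqrt 2 * k * (2 * ((j : ℝ) + 1) * ellK k) *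
      jacobiCn (2 * ((j : ℝ) + 1) * ellK k * x - ellK k) k =
    (-1) ^ (j / 2) * boundState j k x := by
  have hj : (j : ℝ) = 2 * ((j / 2 : ℕ) : ℝ) + ((j % 2 : ℕ) : ℝ) := by
    exact_mod_cast (Nat.div_add_mod j 2).symm
  rw [boundState, show 2 * ((j : ℝ) + 1) * ellK k * x - ellK k =
    (2 * ((j : ℝ) + 1) * ellK k * (x - 1 / 2) + ((j % 2 : ℕ) : ℝ) * ellK k) +
      ((j / 2 : ℕ) : ℝ) * (2 * ellK k) by linear_combination ellK k * hj,
    jacobiCn_add_nat_mul hk]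
  ring

/-- As `μ ≥ 0` forces `2k² - 1 ≥ 0`, the product `(2k² - 1) K(k)²` is strictly increasing on the
relevant range, even with `K` only known to be monotone. -/
theorem IsModulus.unique (hμ : 0 ≤ μ) {j : ℕ} {k l : ℝ} (hk : IsModulus μ j k)
    (hl : IsModulus μ j l) : k = l := by
  have key : ∀ {k l : ℝ}, IsModulus μ j k → IsModulus μ j l → ¬ k < l := by
    intro k l hk hl hkl
    have hK := ellK_pos hk.1
    have hL := ellK_pos hl.1
    have hmono := pow_le_pow_left₀ hK.le (ellK_mono hk.1 hl.1 hkl.le) 2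
    have hk0 := hk.1.1
    have hc : (0 : ℝ) < 4 * ((j : ℝ) + 1) ^ 2 := by positivity
    have h1 : 0 ≤ 2 * k ^ 2 - 1 := by
      by_contra hneg
      have := mul_neg_of_neg_of_pos (not_le.1 hneg) (mul_pos hc (pow_pos hK 2))
      have := hk.2
      linarith
    have hsq : 2 * k ^ 2 - 1 < 2 * l ^ 2 - 1 := by nlinarith
    have h2 : (2 * k ^ 2 - 1) * ellK k ^ 2 < (2 * l ^ 2 - 1) * ellK l ^ 2 :=
      (mul_le_mul_of_nonneg_left hmono h1).trans_lt
        (mul_lt_mul_of_pos_right hsq (pow_pos hL 2))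
    have h3 := mul_lt_mul_of_pos_left h2 hc
    have := hk.2
    have := hl.2
    linarith
  exact le_antisymm (not_lt.1 (key hl hk)) (not_lt.1 (key hk hl))

theorem IsModulus.boundState_eq_boundStateFreq (hμ : 0 < μ) {j : ℕ} {k : ℝ}
    (hk : IsModulus μ j k) (x : ℝ) : boundState j k x = boundStateFreq μ j k x := by
  have hK := ellK_pos hk.1
  set w := 2 * ((j : ℝ) + 1) * ellK k with hw
  have hw0 : 0 < w := by positivity
  have hμ' : μ = w ^ 2 * (2 * k ^ 2 - 1) := by rw [hk.2, hw]; ring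
  have h1 : 0 < 2 * k ^ 2 - 1 := by
    rw [hμ'] at hμ
    exact pos_of_mul_pos_right hμ (sq_nonneg w)
  have hs : Real.sqrt μ = w * Real.sqrt (2 * k ^ 2 - 1) := by
    conv_lhs => rw [hμ']
    rw [Real.sqrt_mul (sq_nonneg w), Real.sqrt_sq hw0.le]
  have hr := (Real.sqrt_pos.2 h1).ne'
  rw [boundState, boundStateFreq, Real.sqrt_mul two_pos.le, hs, ← hw]
  congr 1
  · rw [hw]; field_simp
  · congr 2; field_simp

end Shooting

/-! ### Regularity of weak solutions. -/

section WeakDerivative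

theorem integral_unitVol (f : ℝ → ℝ) : ∫ x, f x ∂unitVol = ∫ x in (0 : ℝ)..1, f x := by
  rw [unitVol, intervalIntegral.integral_of_le zero_le_one, integral_Ioc_eq_integral_Ioo]

instance isFiniteMeasure_unitVol : IsFiniteMeasure unitVol := by
  unfold unitVol; infer_instance

theorem integrable_unitVol_of_continuousOn {f : ℝ → ℝ} (hf : ContinuousOn f (Icc 0 1)) :
    Integrable f unitVol :=
  (hf.integrableOn_Icc).mono_set Ioo_subset_Icc_self

/-- A smooth function with compact support inside `(0,1)`. -/
structure IsTestFunction (η : ℝ → ℝ) : Prop where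
  contDiff : ContDiff ℝ ∞ η
  hasCompactSupport : HasCompactSupport η
  tsupport_subset : tsupport η ⊆ Ioo (0 : ℝ) 1

namespace IsTestFunction

variable {η : ℝ → ℝ}

theorem continuous (h : IsTestFunction η) : Continuous η := h.contDiff.continuous

theorem hasDerivAt (h : IsTestFunction η) (x : ℝ) : HasDerivAt η (deriv η x) x :=
  (h.contDiff.differentiable (by simp)).differentiableAt.hasDerivAt

theorem continuous_deriv (h : IsTestFunction η) : Continuous (deriv η) :=
  h.contDiff.continuous_deriv (by simp)

theorem zero_left (h : IsTestFunction η) : η 0 = 0 :=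
  image_eq_zero_of_notMem_tsupport fun h0 => lt_irrefl _ (h.tsupport_subset h0).1

theorem zero_right (h : IsTestFunction η) : η 1 = 0 :=
  image_eq_zero_of_notMem_tsupport fun h0 => lt_irrefl _ (h.tsupport_subset h0).2

theorem integral_mul_deriv (h : IsTestFunction η) {f g : ℝ → ℝ}
    (hf : ∀ x, HasDerivAt f (g x) x) (hg : Continuous g) :
    ∫ x, f x * deriv η x ∂unitVol = -∫ x, g x * η x ∂unitVol := by
  rw [integral_unitVol, integral_unitVol,
    intervalIntegral.integral_mul_deriv_eq_deriv_mul (fun x _ => hf x)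
      (fun x _ => h.hasDerivAt x) (hg.intervalIntegrable _ _)
      (h.continuous_deriv.intervalIntegrable _ _), h.zero_left, h.zero_right]
  ring

theorem memLp (h : IsTestFunction η) : MemLp η 2 unitVol :=
  (h.continuous.memLp_of_hasCompactSupport h.hasCompactSupport).restrict _

theorem memLp_deriv (h : IsTestFunction η) : MemLp (deriv η) 2 unitVol :=
  (h.continuous_deriv.memLp_of_hasCompactSupport h.hasCompactSupport.deriv).restrict _

theorem memH10 (h : IsTestFunction η) : MemH10 η (deriv η) where
  memLp := h.memLp
  memLp_deriv := h.memLp_deriv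
  weak_deriv _ h1 h2 h3 :=
    IsTestFunction.integral_mul_deriv ⟨h1, h2, h3⟩ h.hasDerivAt h.continuous_deriv
  boundary := ⟨η, h.continuous.continuousOn, Filter.EventuallyEq.rfl, h.zero_left, h.zero_right⟩

theorem integrable_mul {f : ℝ → ℝ} (h : IsTestFunction η) (hf : Integrable f unitVol) :
    Integrable (fun x => f x * η x) unitVol := by
  obtain ⟨C, hC⟩ := h.continuous.bounded_above_of_compact_support h.hasCompactSupport
  exact hf.mul_bdd h.continuous.aestronglyMeasurable (Filter.Eventually.of_forall hC)

theorem integrable_mul_deriv {f : ℝ → ℝ} (h : IsTestFunction η) (hf : Integrable f unitVol) :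
    Integrable (fun x => f x * deriv η x) unitVol := by
  obtain ⟨C, hC⟩ := h.continuous_deriv.bounded_above_of_compact_support h.hasCompactSupport.deriv
  exact hf.mul_bdd h.continuous_deriv.aestronglyMeasurable (Filter.Eventually.of_forall hC)

/-- The primitive from `0` vanishes left of the support, and right of it equals the total integral,
which is zero. -/
theorem exists_primitive (h : IsTestFunction η) (h0 : ∫ x, η x ∂unitVol = 0) :
    ∃ ξ : ℝ → ℝ, IsTestFunction ξ ∧ deriv ξ = η := by
  have hder : ∀ x, HasDerivAt (fun x => ∫ t in (0 : ℝ)..x, η t) (η x) x := fun x =>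
    (h.continuous.integral_hasStrictDerivAt 0 x).hasDerivAt
  have hderiv : deriv (fun x => ∫ t in (0 : ℝ)..x, η t) = η := funext fun x => (hder x).deriv
  -- The point `1/2` keeps the set nonempty when `η = 0`.
  have hcpt : IsCompact (insert (1 / 2 : ℝ) (tsupport η)) :=
    (show IsCompact (tsupport η) from h.hasCompactSupport).insert _
  have hsub : insert (1 / 2 : ℝ) (tsupport η) ⊆ Ioo 0 1 :=
    insert_subset (by norm_num) h.tsupport_subset
  obtain ⟨a, ha, ha'⟩ := hcpt.exists_isLeast (insert_nonempty _ _)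
  obtain ⟨b, hb, hb'⟩ := hcpt.exists_isGreatest (insert_nonempty _ _)
  have hη0 : ∀ t, t ∉ Icc a b → η t = 0 := fun t ht =>
    image_eq_zero_of_notMem_tsupport fun hmem =>
      ht ⟨ha' (mem_insert_of_mem _ hmem), hb' (mem_insert_of_mem _ hmem)⟩
  have hsupp : Function.support (fun x => ∫ t in (0 : ℝ)..x, η t) ⊆ Icc a b := by
    intro x hx
    by_contra hxab
    apply hx
    rw [mem_Icc, not_and_or, not_le, not_le] at hxab
    rcases hxab with hxa | hxb
    · refine (intervalIntegral.integral_congr (g := 0) fun t ht => hη0 t fun htI => ?_).trans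
        (by simp)
      exact absurd (ht.2.trans_lt (max_lt (hsub ha).1 hxa)) (not_lt.2 htI.1)
    · have hsplit := intervalIntegral.integral_add_adjacent_intervals
        (h.continuous.intervalIntegrable (μ := volume) 0 1)
        (h.continuous.intervalIntegrable (μ := volume) 1 x)
      rw [← integral_unitVol, h0, zero_add] at hsplit
      change ∫ t in (0 : ℝ)..x, η t = 0
      rw [← hsplit]
      refine (intervalIntegral.integral_congr (g := 0) fun t ht => hη0 t fun htI => ?_).trans
        (by simp)
      exact absurd ((lt_min (hsub hb).2 hxb).trans_le ht.1) (not_lt.2 htI.2)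
  have htsupp : tsupport (fun x => ∫ t in (0 : ℝ)..x, η t) ⊆ Icc a b :=
    closure_minimal hsupp isClosed_Icc
  refine ⟨_, ⟨?_, isCompact_Icc.of_isClosed_subset (isClosed_tsupport _) htsupp,
    htsupp.trans (Icc_subset_Ioo (hsub ha).1 (hsub hb).2)⟩, hderiv⟩
  rw [contDiff_infty_iff_deriv, hderiv]
  exact ⟨fun x => (hder x).differentiableAt, h.contDiff⟩

theorem exists_integral_eq_one : ∃ η : ℝ → ℝ, IsTestFunction η ∧ ∫ x, η x ∂unitVol = 1 := by
  let f : ContDiffBump (1 / 2 : ℝ) := ⟨1 / 8, 1 / 4, by norm_num, by norm_num⟩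
  have hsub : tsupport (f.normed volume) ⊆ Ioo (0 : ℝ) 1 := by
    rw [f.tsupport_normed_eq, Real.closedBall_eq_Icc]
    exact Icc_subset_Ioo (by norm_num [f]) (by norm_num [f])
  refine ⟨f.normed volume, ⟨f.contDiff_normed, f.hasCompactSupport_normed, hsub⟩, ?_⟩
  rw [unitVol, setIntegral_eq_integral_of_forall_compl_eq_zero, f.integral_normed]
  exact fun x hx => image_eq_zero_of_notMem_tsupport fun h => hx (hsub h)

theorem sub_const_mul {ξ : ℝ → ℝ} (h : IsTestFunction η) (hξ : IsTestFunction ξ) (c : ℝ) :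
    IsTestFunction fun x => η x - c * ξ x where
  contDiff := h.contDiff.sub (contDiff_const.mul hξ.contDiff)
  hasCompactSupport := h.hasCompactSupport.sub hξ.hasCompactSupport.mul_left
  tsupport_subset := (tsupport_sub _ _).trans (union_subset h.tsupport_subset
    ((tsupport_mul_subset_right (f := fun _ => c) (g := ξ)).trans hξ.tsupport_subset))

end IsTestFunction

/-- The du Bois-Reymond lemma: a function with vanishing weak derivative is constant. -/
theorem ae_eq_const_of_integral_mul_deriv_eq_zero {f : ℝ → ℝ} (hf : Integrable f unitVol)
    (h : ∀ η, IsTestFunction η → ∫ x, f x * deriv η x ∂unitVol = 0) :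
    ∃ c : ℝ, ∀ᵐ x ∂unitVol, f x = c := by
  obtain ⟨ρ, hρ, hρ1⟩ := IsTestFunction.exists_integral_eq_one
  refine ⟨∫ x, f x * ρ x ∂unitVol, ?_⟩
  set c := ∫ x, f x * ρ x ∂unitVol with hc
  have hfc : Integrable (fun x => f x - c) unitVol := hf.sub (integrable_const c)
  have key : ∀ᵐ x, x ∈ Ioo (0 : ℝ) 1 → f x - c = 0 := by
    refine isOpen_Ioo.ae_eq_zero_of_integral_contDiff_smul_eq_zero
      (IntegrableOn.locallyIntegrableOn hfc) fun g hg1 hg2 hg3 => ?_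
    have hg : IsTestFunction g := ⟨hg1, hg2, hg3⟩
    have hgi : Integrable g unitVol := hg.memLp.integrable one_le_two
    have hρi : Integrable ρ unitVol := hρ.memLp.integrable one_le_two
    -- Subtracting `(∫ g) ρ` makes the mean of `g` zero, so the difference is the derivative of a
    -- test function `ξ`. Testing with `ξ` gives `∫ f g = c ∫ g`.
    have hη := hg.sub_const_mul hρ (∫ x, g x ∂unitVol)
    obtain ⟨ξ, hξ, hξ'⟩ := hη.exists_primitive (by
      rw [integral_sub hgi (hρi.const_mul _), integral_const_mul, hρ1]; ring)
    have h0 := h ξ hξ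
    simp only [hξ', mul_sub] at h0
    have hrw : ∀ x, f x * ((∫ x, g x ∂unitVol) * ρ x) = (∫ x, g x ∂unitVol) * (f x * ρ x) :=
      fun x => by ring
    simp only [hrw] at h0
    rw [integral_sub (hg.integrable_mul hf) ((hρ.integrable_mul hf).const_mul _),
      integral_const_mul, ← hc] at h0
    rw [← setIntegral_eq_integral_of_forall_compl_eq_zero (s := Ioo (0 : ℝ) 1)]
    · change ∫ x, g x • (f x - c) ∂unitVol = 0
      have hrw' : ∀ x, g x • (f x - c) = f x * g x - c * g x := fun x => by
        rw [smul_eq_mul]; ring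
      simp only [hrw']
      rw [integral_sub (hg.integrable_mul hf) (hgi.const_mul _), integral_const_mul]
      linarith
    · intro x hx
      rw [image_eq_zero_of_notMem_tsupport fun hmem => hx (hg3 hmem), zero_smul]
  rw [unitVol, ae_restrict_iff' measurableSet_Ioo]
  filter_upwards [key] with x hx hx'
  exact sub_eq_zero.1 (hx hx')

theorem ae_eq_add_const_of_integral_mul_deriv_eq {f g : ℝ → ℝ} (hf : Integrable f unitVol)
    (hg : Integrable g unitVol)
    (h : ∀ η, IsTestFunction η →
      ∫ x, f x * deriv η x ∂unitVol = ∫ x, g x * deriv η x ∂unitVol) :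
    ∃ c : ℝ, ∀ᵐ x ∂unitVol, f x = g x + c := by
  obtain ⟨c, hc⟩ := ae_eq_const_of_integral_mul_deriv_eq_zero (hf.sub hg) fun η hη => by
    simp only [Pi.sub_apply, sub_mul]
    rw [integral_sub (hη.integrable_mul_deriv hf) (hη.integrable_mul_deriv hg), h η hη, sub_self]
  refine ⟨c, hc.mono fun x hx => ?_⟩
  rw [← hx, Pi.sub_apply]
  ring

/-- The du Bois-Reymond lemma is applied twice: the equation identifies `ψ'` with `q + c`, then the
weak derivative identifies `ψ` with a primitive of `q + c`. -/
theorem exists_classical_solution {μ : ℝ} {ψ ψ' : ℝ → ℝ} (hψ : MemH10 ψ ψ')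
    (hweak : ∀ v v' : ℝ → ℝ, MemH10 v v' →
      ∫ x, (ψ' x * v' x + μ * ψ x * v x - ψ x ^ 3 * v x) ∂unitVol = 0) :
    ∃ u p : ℝ → ℝ, u =ᵐ[unitVol] ψ ∧ (∀ x, HasDerivAt u (p x) x) ∧
      (∀ x ∈ Icc (0 : ℝ) 1, HasDerivAt p (μ * u x - u x ^ 3) x) ∧ u 0 = 0 ∧ u 1 = 0 := by
  obtain ⟨w, hw, hwψ, hw0, hw1⟩ := hψ.boundary
  -- Extending the continuous representative to the line makes its primitives differentiable
  -- everywhere.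
  set W : ℝ → ℝ := IccExtend zero_le_one ((Icc (0 : ℝ) 1).domRestrict w) with hW
  have hWc : Continuous W := hw.domRestrict.Icc_extend'
  have hWw : ∀ x ∈ Icc (0 : ℝ) 1, W x = w x := fun x hx => IccExtend_of_mem _ _ hx
  have hWψ : ∀ᵐ x ∂unitVol, W x = ψ x := by
    have hmem : ∀ᵐ x ∂unitVol, x ∈ Ioo (0 : ℝ) 1 := ae_restrict_mem measurableSet_Ioo
    filter_upwards [hwψ, hmem] with x hx hx'
    rw [hWw x (Ioo_subset_Icc_self hx'), hx]
  have hGc : Continuous fun x => μ * W x - W x ^ 3 := by fun_prop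
  have hq : ∀ x, HasDerivAt (fun x => ∫ t in (0 : ℝ)..x, (μ * W t - W t ^ 3))
      (μ * W x - W x ^ 3) x := fun x => (hGc.integral_hasStrictDerivAt 0 x).hasDerivAt
  set q : ℝ → ℝ := fun x => ∫ t in (0 : ℝ)..x, (μ * W t - W t ^ 3)
  have hqc : Continuous q := continuous_iff_continuousAt.2 fun x => (hq x).continuousAt
  have hψi : Integrable ψ unitVol := hψ.memLp.integrable one_le_two
  have hψi' : Integrable ψ' unitVol := hψ.memLp_deriv.integrable one_le_two
  obtain ⟨c, hc⟩ := ae_eq_add_const_of_integral_mul_deriv_eq hψi'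
    (integrable_unitVol_of_continuousOn hqc.continuousOn) fun η hη => by
      have hG : Integrable (fun x => (μ * W x - W x ^ 3) * η x) unitVol :=
        hη.integrable_mul (integrable_unitVol_of_continuousOn hGc.continuousOn)
      have h0 : ∫ x, (ψ' x * deriv η x + (μ * W x - W x ^ 3) * η x) ∂unitVol = 0 := by
        rw [← hweak η (deriv η) hη.memH10]
        refine integral_congr_ae (hWψ.mono fun x hx => ?_)
        simp only [hx]
        ring
      rw [integral_add (hη.integrable_mul_deriv hψi') hG] at h0
      rw [hη.integral_mul_deriv hq hGc]
      linarith
  have hpc : Continuous fun x => q x + c := by fun_prop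
  have hr : ∀ x, HasDerivAt (fun x => ∫ t in (0 : ℝ)..x, (q t + c)) (q x + c) x := fun x =>
    (hpc.integral_hasStrictDerivAt 0 x).hasDerivAt
  set r : ℝ → ℝ := fun x => ∫ t in (0 : ℝ)..x, (q t + c)
  have hrc : Continuous r := continuous_iff_continuousAt.2 fun x => (hr x).continuousAt
  obtain ⟨d, hd⟩ := ae_eq_add_const_of_integral_mul_deriv_eq hψi
    (integrable_unitVol_of_continuousOn hrc.continuousOn) fun η hη => by
      rw [hψ.weak_deriv η hη.contDiff hη.hasCompactSupport hη.tsupport_subset,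
        hη.integral_mul_deriv hr hpc]
      congr 1
      exact integral_congr_ae (hc.mono fun x hx => by simp only [hx])
  -- Continuity upgrades a.e. equality to all of `[0,1]`; the endpoints are needed for the boundary
  -- values.
  have huW : EqOn (fun x => r x + d) W (Icc (0 : ℝ) 1) := by
    refine Measure.eqOn_Icc_of_ae_eq volume zero_ne_one ?_ (by fun_prop) hWc.continuousOn
    rw [← restrict_Ioo_eq_restrict_Icc]
    filter_upwards [hd, hWψ] with x h1 h2
    rw [h2, h1]
  refine ⟨fun x => r x + d, fun x => q x + c, hd.mono fun x hx => hx.symm,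
    fun x => (hr x).add_const d, fun x hx => ?_, ?_, ?_⟩
  · rw [huW hx]
    exact (hq x).add_const c
  · rw [huW (left_mem_Icc.2 zero_le_one), hWw 0 (left_mem_Icc.2 zero_le_one), hw0]
  · rw [huW (right_mem_Icc.2 zero_le_one), hWw 1 (right_mem_Icc.2 zero_le_one), hw1]

/-- Bootstrapping: the right-hand sides of `u' = p` and `p' = μ u - u³` are polynomial in `(u, p)`,
so each round gains one derivative. -/
theorem contDiffOn_of_cubic_ode {μ : ℝ} {u p : ℝ → ℝ}
    (hu : ∀ x ∈ Ioo (0 : ℝ) 1, HasDerivAt u (p x) x)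
    (hp : ∀ x ∈ Ioo (0 : ℝ) 1, HasDerivAt p (μ * u x - u x ^ 3) x) :
    ContDiffOn ℝ ∞ u (Ioo (0 : ℝ) 1) := by
  have step : ∀ {f g : ℝ → ℝ} {n : ℕ}, (∀ x ∈ Ioo (0 : ℝ) 1, HasDerivAt f (g x) x) →
      ContDiffOn ℝ n g (Ioo 0 1) → ContDiffOn ℝ (n + 1 : ℕ) f (Ioo 0 1) := by
    intro f g n hf hg
    rw [Nat.cast_succ, contDiffOn_succ_iff_deriv_of_isOpen isOpen_Ioo]
    exact ⟨fun x hx => (hf x hx).differentiableAt.differentiableWithinAt,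
      -- The analyticity clause concerns only the exponent `ω`, which a natural number is not.
      fun h => absurd h (by simp), hg.congr fun x hx => (hf x hx).deriv⟩
  have main : ∀ n : ℕ, ContDiffOn ℝ n u (Ioo (0 : ℝ) 1) ∧ ContDiffOn ℝ n p (Ioo (0 : ℝ) 1) := by
    intro n
    induction n with
    | zero =>
      simp only [Nat.cast_zero, contDiffOn_zero]
      exact ⟨fun x hx => (hu x hx).continuousAt.continuousWithinAt,
        fun x hx => (hp x hx).continuousAt.continuousWithinAt⟩
    | succ n ih =>
      exact ⟨step hu ih.2, step hp ((contDiffOn_const.mul ih.1).sub (ih.1.pow 3))⟩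
  exact contDiffOn_infty.2 fun n => (main n).1

end WeakDerivative

/-! ### Reduction to positive slope and conclusion. -/

theorem exists_isModulus_eq_sign_mul_boundState {μ : ℝ} {u p : ℝ → ℝ}
    (hu : ∀ x ∈ Icc (0 : ℝ) 1, HasDerivAt u (p x) x)
    (hp : ∀ x ∈ Icc (0 : ℝ) 1, HasDerivAt p (μ * u x - u x ^ 3) x)
    (h0 : u 0 = 0) (h1 : u 1 = 0) (hne : ∃ x ∈ Icc (0 : ℝ) 1, u x ≠ 0) :
    ∃ j : ℕ, ∃ k : ℝ, IsModulus μ j k ∧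
      {x ∈ Ioo (0 : ℝ) 1 | u x = 0}.encard = (j : ℕ∞) ∧
      ((∀ x ∈ Icc (0 : ℝ) 1, u x = boundState j k x) ∨
        (∀ x ∈ Icc (0 : ℝ) 1, u x = -boundState j k x)) := by
  -- The nonlinearity is odd, so `-u` is again a solution; zero slope would make `u` vanish
  -- identically.
  wlog hpos : 0 < p 0 generalizing u p
  · rcases (not_lt.1 hpos).lt_or_eq with hneg | hzero
    · obtain ⟨x, hx, hux⟩ := hne
      obtain ⟨j, k, hk, hz, hb⟩ := this (u := fun x => -u x) (p := fun x => -p x)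
        (fun x hx => (hu x hx).fun_neg)
        (fun x hx => (hp x hx).fun_neg.congr_deriv (by ring)) (by simp [h0]) (by simp [h1])
        ⟨x, hx, neg_ne_zero.2 hux⟩ (by linarith)
      simp only [neg_eq_zero] at hz
      refine ⟨j, k, hk, hz, hb.symm.imp (fun h x hx => neg_inj.1 (h x hx)) fun h x hx => ?_⟩
      rw [← h x hx, neg_neg]
    · obtain ⟨x, hx, hux⟩ := hne
      refine absurd (eqOn_of_cubic_ode (μ := μ) (v := fun _ => 0) (q := fun _ => 0) hu hp
        (fun x _ => hasDerivAt_const x _)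
        (fun x _ => (hasDerivAt_const x _).congr_deriv (by ring)) h0 hzero hx) hux
  · obtain ⟨j, k, hk0, hk, hcn⟩ := exists_isModulus_eq_cnWave hu hp h0 h1 hpos
    have hK := ellK_pos hk.1
    refine ⟨j, k, hk, ?_, ?_⟩
    · rw [← encard_zeros_cnWave j hk.1]
      congr 1
      ext x
      refine and_congr_right fun hx => ?_
      -- The amplitude is nonzero because `k > 0`, so `u` and `cn` have the same zeros.
      rw [hcn x (Ioo_subset_Icc_self hx), mul_eq_zero, or_iff_right (by positivity)]
    · simp only [boundState_eq_cnWave j hk.1] at hcn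
      rcases neg_one_pow_eq_or ℝ (j / 2) with h | h
      · exact Or.inl fun x hx => by rw [hcn x hx, h, one_mul]
      · exact Or.inr fun x hx => by rw [hcn x hx, h, neg_one_mul]

theorem mainTheorem7 (μ : ℝ) (hμ : 0 ≤ μ) (ψ ψ' : ℝ → ℝ) (hψ : MemH10 ψ ψ')
    (hne : ¬ ψ =ᵐ[unitVol] 0)
    (hweak : ∀ v v' : ℝ → ℝ, MemH10 v v' →
      ∫ x, (ψ' x * v' x + μ * ψ x * v x - ψ x ^ 3 * v x) ∂unitVol = 0) :
    ∃ u : ℝ → ℝ, u =ᵐ[unitVol] ψ ∧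
      -- classical solution
      ContDiffOn ℝ ∞ u (Ioo (0 : ℝ) 1) ∧ ContinuousOn u (Icc (0 : ℝ) 1) ∧
      (∀ x ∈ Ioo (0 : ℝ) 1, -deriv (deriv u) x + μ * u x - u x ^ 3 = 0) ∧
      u 0 = 0 ∧ u 1 = 0 ∧
      ∃ j : ℕ,
        -- exactly `j` interior zeros
        {x ∈ Ioo (0 : ℝ) 1 | u x = 0}.encard = (j : ℕ∞) ∧
        -- the modulus `k = k_j(μ)` is well defined, and `u = ± φ_j`
        (∃! k : ℝ, IsModulus μ j k) ∧
        ∀ k : ℝ, IsModulus μ j k →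
          ((∀ x ∈ Icc (0 : ℝ) 1, u x = boundState j k x) ∨
            (∀ x ∈ Icc (0 : ℝ) 1, u x = -boundState j k x)) ∧
          (0 < μ → ∀ x : ℝ, boundState j k x = boundStateFreq μ j k x) := by
  obtain ⟨u, p, hψu, hu, hp, h0, h1⟩ := exists_classical_solution hψ hweak
  have hp' : ∀ x ∈ Ioo (0 : ℝ) 1, HasDerivAt p (μ * u x - u x ^ 3) x :=
    fun x hx => hp x (Ioo_subset_Icc_self hx)
  have hne' : ∃ x ∈ Icc (0 : ℝ) 1, u x ≠ 0 := by
    by_contra! h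
    refine hne (hψu.symm.trans ?_)
    filter_upwards [ae_restrict_mem measurableSet_Ioo] with x hx
    exact h x (Ioo_subset_Icc_self hx)
  obtain ⟨j, k, hk, hz, hb⟩ :=
    exists_isModulus_eq_sign_mul_boundState (fun x _ => hu x) hp h0 h1 hne'
  refine ⟨u, hψu, contDiffOn_of_cubic_ode (fun x _ => hu x) hp',
    fun x _ => (hu x).continuousAt.continuousWithinAt, fun x hx => ?_, h0, h1, j, hz,
    ⟨k, hk, fun l hl => hl.unique hμ hk⟩, fun l hl => ⟨?_, fun hμ' x =>
      hl.boundState_eq_boundStateFreq hμ' x⟩⟩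
  · rw [show deriv u = p from funext fun x => (hu x).deriv, (hp' x hx).deriv]
    ring
  · rwa [hl.unique hμ hk]
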